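/- For integers $p \ge 1$ and $n \ge 0$, the Hanoi graph $H_p^n$ has as vertices the configurations $(p_1,\dots,p_n)\in\{1,\dots,p\}^n$ of $n$ disks $d_1,\dots,d_n$ (listed in order of increasing size) on $p$ pegs, where $p_i$ is the peg holding $d_i$. Two configurations are adjacent if and only if they differ in exactly one coordinate $i$, say with values $p_i \neq p_i'$ there, and no smaller disk $d_j$, $j<i$, is on peg $p_i$ or on peg $p_i'$. A tree decomposition of a finite graph $G$ is a finite tree $T$, each of whose nodes carries a set of vertices of $G$ (a bag), such that every vertex of $G$ lies in some bag, any two adjacent vertices of $G$ lie in a common bag, and whenever a vertex lies in the bags of two nodes it lies in the bag of every node on the path of $T$ between them. Its width is the maximum size of a bag minus one, and the treewidth $\operatorname{tw}(G)$ is the minimum width of a tree decomposition of $G$. **Theorem 4.8.** For every fixed integer $p \ge 4$, as $n \to \infty$, $$\operatorname{tw}(H_p^n) = \Omega\bigl(n^{-(p-1)/2}\,(p-2)^n\bigr);$$ that is, there are a constant $c>0$ and an integer $N$, depending only on $p$, such that $\operatorname{tw}(H_p^n) \ge c\, n^{-(p-1)/2}(p-2)^n$ for all $n\ge N$. -/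

import Mathlib

/-- The Hanoi graph with `p` pegs and `n` disks. A vertex is a configuration `c : Fin n → Fin p`,
where `c i` is the peg holding disk `i`, and the disks are indexed in order of increasing size.
Two configurations are adjacent when they differ in exactly one disk `i` and no smaller disk lies
on either of the two pegs `c i`, `d i`. -/
def hanoiGraph (p n : ℕ) : SimpleGraph (Fin n → Fin p) where
  Adj c d := ∃ i, c i ≠ d i ∧ (∀ j, j ≠ i → c j = d j) ∧ ∀ j, j < i → c j ≠ c i ∧ c j ≠ d i
  symm := ⟨by
    rintro c d ⟨i, hne, heq, hlt⟩
    refine ⟨i, hne.symm, fun j hj => (heq j hj).symm, fun j hj => ?_⟩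
    rw [← heq j hj.ne]
    exact ⟨(hlt j hj).2, (hlt j hj).1⟩⟩
  loopless := ⟨by
    rintro c ⟨i, hne, -⟩
    exact hne rfl⟩

/-- A tree decomposition of `G`, with the nodes of the tree indexed by `ι`. -/
structure TreeDecomposition {V : Type*} (G : SimpleGraph V) (ι : Type*) where
  tree : SimpleGraph ι
  isTree : tree.IsTree
  bag : ι → Finset V
  /-- Adjacent vertices share a bag. -/
  exists_bag_of_adj : ∀ u v, G.Adj u v → ∃ i, u ∈ bag i ∧ v ∈ bag i
  /-- A vertex in two bags is in every bag on the tree path between them. -/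
  mem_bag_of_mem_path : ∀ (v : V) (i j : ι) (w : tree.Walk i j), w.IsPath →
    v ∈ bag i → v ∈ bag j → ∀ k ∈ w.support, v ∈ bag k
  /-- Every vertex is in some bag. -/
  exists_bag : ∀ v, ∃ i, v ∈ bag i

/-- The width: the maximum size of a bag, minus one. (If `V` is nonempty, some bag is nonempty,
so the subtraction is not truncated.) -/
def TreeDecomposition.width {V : Type*} {G : SimpleGraph V} {ι : Type*} [Fintype ι]
    (D : TreeDecomposition G ι) : ℕ :=
  (Finset.univ.sup fun i => (D.bag i).card) - 1

/-- The treewidth of a finite graph: the minimum width over all tree decompositions whose tree is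
finite (up to relabelling of the nodes, a tree on `Fin m`). -/
noncomputable def treewidth {V : Type*} [Finite V] (G : SimpleGraph V) : ℕ :=
  sInf {k | ∃ (m : ℕ) (D : TreeDecomposition G (Fin m)), D.width = k}

/-- The minimum in the definition of `treewidth` is over a nonempty set: there is always
the decomposition with a single bag. -/
theorem exists_treeDecomposition_width_eq {V : Type*} [Finite V] (G : SimpleGraph V) :
    ∃ (m : ℕ) (D : TreeDecomposition G (Fin m)), D.width = treewidth G := by
  classical
  have := Fintype.ofFinite V
  refine Nat.sInf_mem (s := {k | ∃ (m : ℕ) (D : TreeDecomposition G (Fin m)), D.width = k})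
    ⟨_, 1, ⟨⊥, ?_, fun _ => Finset.univ, ?_, ?_, ?_⟩, rfl⟩
  · exact SimpleGraph.IsTree.of_subsingleton
  · exact fun _ _ _ => ⟨0, Finset.mem_univ _, Finset.mem_univ _⟩
  · exact fun _ _ _ _ _ _ _ _ _ => Finset.mem_univ _
  · exact fun _ => ⟨0, Finset.mem_univ _⟩

/-! Write p = q + 3. Split the n disks into q classes of k disks, each class parked on a peg of its
own, and one larger class of m disks that roams freely on the other three pegs. These configurations
form a connected set (`hanoiGraph_joinedWithin`). So does each translate by an element of Γ = S_n ×
S_p, which permutes disks and pegs: Γ need not preserve adjacency, but the connectivity argument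
ignores which disks are in which class.

A vertex lies in at most p! m! (k!)^q of the translates, indexed by the n! p! elements of Γ
(`card_filter_mem_permTranslate_le`), so deleting few vertices damages few translates. Every element
of Γ is a product of O(n) elements whose translate meets the base set
(`IsBalancedColoring.hasRoute`). By averaging, a majority of the translates survives and hangs
together through intersections (`exists_majority_of_hasRoute`). One marked point per translate then
gives a majority that no small bag can separate (`le_treewidth_of_majority`).

Hence the treewidth is at least of order n! / (n m! (k!)^q). With m close to k, Stirling's formula
makes this (q+1)^n / n^(1 + q/2), where q + 1 = p - 2 and 1 + q/2 = (p-1)/2. -/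

namespace SimpleGraph

/-! ### First steps of paths in trees, and walks inside a set. -/

variable {ι : Type*} {T : SimpleGraph ι}

/-- The first step of the path from `t` to `s` in a tree. -/
noncomputable def IsTree.next (hT : T.IsTree) (t s : ι) : ι :=
  (hT.existsUnique_path t s).choose.snd

theorem IsTree.next_eq (hT : T.IsTree) {t s : ι} (w : T.Walk t s) (hw : w.IsPath) :
    hT.next t s = w.snd := by
  rw [IsTree.next, (hT.existsUnique_path t s).unique (hT.existsUnique_path t s).choose_spec.1 hw]

theorem IsTree.adj_next (hT : T.IsTree) {t s : ι} (h : t ≠ s) : T.Adj t (hT.next t s) :=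
  Walk.adj_snd (Walk.not_nil_of_ne h)

/-- The path to `s'` is a truncation of the path to `s` or extends it by one edge; neither changes
the first step. -/
theorem IsTree.next_eq_of_adj (hT : T.IsTree) {t s s' : ι} (hs : t ≠ s) (hs' : t ≠ s')
    (h : T.Adj s s') : hT.next t s = hT.next t s' := by
  classical
  obtain ⟨w, hw, -⟩ := hT.existsUnique_path t s
  rw [hT.next_eq w hw]
  by_cases hmem : s' ∈ w.support
  · rw [hT.next_eq _ (hw.takeUntil hmem)]
    exact (Walk.snd_takeUntil hs'.symm w hmem).symm
  · rw [hT.next_eq _ (hw.concat hmem h)]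
    cases w with
    | nil => exact absurd rfl hs
    | cons h' w' => simp [Walk.concat_cons]

theorem IsTree.next_eq_of_walk (hT : T.IsTree) {t s s' : ι} (w : T.Walk s s')
    (h : t ∉ w.support) : hT.next t s = hT.next t s' := by
  induction w with
  | nil => rfl
  | cons hadj w ih =>
    rw [Walk.support_cons, List.mem_cons, not_or] at h
    refine (hT.next_eq_of_adj h.1 (fun e => h.2 ?_) hadj).trans (ih h.2)
    rw [e]; exact w.start_mem_support

theorem IsTree.next_next_ne (hT : T.IsTree) {t t' s : ι} (h : t ≠ s) (h' : t' ≠ s)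
    (e : hT.next t s = t') : hT.next t' s ≠ t := by
  obtain ⟨w, hw, -⟩ := hT.existsUnique_path t s
  rw [hT.next_eq w hw] at e
  cases w with
  | nil => exact absurd rfl h
  | cons hadj w =>
    simp only [Walk.snd_cons] at e
    subst e
    rw [Walk.cons_isPath_iff] at hw
    rw [hT.next_eq w hw.1]
    intro e
    exact hw.2 (e ▸ w.getVert_mem_support 1)

/-- A map sending each node of a finite tree to a neighbour swaps two nodes. -/
theorem IsTree.exists_involutive_pair [Finite ι] (hT : T.IsTree) (f : ι → ι)
    (hf : ∀ t, T.Adj t (f t)) : ∃ t, f (f t) = t := by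
  classical
  have := Fintype.ofFinite ι
  have hcard := hT.card_edgeFinset
  -- A tree has fewer edges than nodes, so two nodes choose the same edge.
  obtain ⟨t, -, t', -, hne, he⟩ := Finset.exists_ne_map_eq_of_card_lt_of_maps_to
    (s := Finset.univ) (t := T.edgeFinset) (f := fun t => s(t, f t))
    (by rw [Finset.card_univ]; omega) (fun t _ => by simpa using hf t)
  simp only [Sym2.eq_iff] at he
  rcases he with he | he
  · exact absurd he.1 hne
  · exact ⟨t, by rw [he.2, ← he.1]⟩

/-- `u` and `v` are joined by a walk inside `s` (or equal). -/
def JoinedWithin {V : Type*} (G : SimpleGraph V) (s : Set V) : V → V → Prop :=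
  Relation.ReflTransGen fun a b => G.Adj a b ∧ a ∈ s ∧ b ∈ s

namespace JoinedWithin

variable {V : Type*} {G : SimpleGraph V} {s t : Set V} {u v : V}

theorem mono (hst : s ⊆ t) (h : G.JoinedWithin s u v) : G.JoinedWithin t u v :=
  Relation.ReflTransGen.mono (fun _ _ h => ⟨h.1, hst h.2.1, hst h.2.2⟩) _ _ h

theorem symm (h : G.JoinedWithin s u v) : G.JoinedWithin s v u :=
  have : Std.Symm fun a b => G.Adj a b ∧ a ∈ s ∧ b ∈ s := ⟨fun _ _ h => ⟨h.1.symm, h.2.2, h.2.1⟩⟩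
  Relation.ReflTransGen.stdSymm.symm _ _ h

end JoinedWithin

end SimpleGraph

/-! ### Bags and inseparable majorities. -/

namespace TreeDecomposition

variable {V ι : Type*} {G : SimpleGraph V} (D : TreeDecomposition G ι)

/-- The nodes whose bags contain `v` span a subtree; it avoids `t`, so it lies on one side of `t`.
-/
theorem next_eq_of_mem_bag {t s s' : ι} {v : V} (ht : v ∉ D.bag t) (hs : v ∈ D.bag s)
    (hs' : v ∈ D.bag s') : D.isTree.next t s = D.isTree.next t s' := by
  obtain ⟨w, hw, -⟩ := D.isTree.existsUnique_path s s'
  exact D.isTree.next_eq_of_walk w fun h => ht (D.mem_bag_of_mem_path v s s' w hw hs hs' t h)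

theorem next_eq_of_joinedWithin {t s s' : ι} {u v : V}
    (h : G.JoinedWithin (D.bag t : Set V)ᶜ u v) (hu : u ∉ D.bag t)
    (hs : u ∈ D.bag s) (hs' : v ∈ D.bag s') : D.isTree.next t s = D.isTree.next t s' := by
  induction h generalizing s' with
  | refl => exact D.next_eq_of_mem_bag hu hs hs'
  | tail _ h ih =>
    obtain ⟨r, hr, hr'⟩ := D.exists_bag_of_adj _ _ h.1
    exact (ih hr).trans (D.next_eq_of_mem_bag (by simpa using h.2.2) hr' hs')

/-- If the deletion of any set of at most `s` vertices leaves more than half of the marked points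
connected to each other, then some bag has more than `s` vertices. -/
theorem exists_lt_card_bag [Finite ι] {M : Type*} [Fintype M] (r : M → V) (s : ℕ)
    (h : ∀ S : Finset V, S.card ≤ s → ∃ B : Finset M, Fintype.card M < 2 * B.card ∧
      (∀ x ∈ B, r x ∉ S) ∧ ∀ x ∈ B, ∀ y ∈ B, G.JoinedWithin (S : Set V)ᶜ (r x) (r y)) :
    ∃ t, s < (D.bag t).card := by
  classical
  by_contra! hs
  choose B hcard hB hconn using fun t => h (D.bag t) (hs t)
  choose node hnode using D.exists_bag
  have hne : ∀ t, (B t).Nonempty := fun t => by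
    rw [← Finset.card_pos]; have := hcard t; omega
  choose x hx using hne
  have hnode_ne : ∀ t, ∀ y ∈ B t, t ≠ node (r y) := fun t y hy e =>
    hB t y hy (by rw [e]; exact hnode _)
  -- Each node points towards the majority left after deleting its bag. Some edge is pointed along
  -- in both directions, yet the majorities at its two ends share a marked point.
  obtain ⟨t, ht⟩ := D.isTree.exists_involutive_pair (fun t => D.isTree.next t (node (r (x t))))
    (fun t => D.isTree.adj_next (hnode_ne t _ (hx t)))
  set t' := D.isTree.next t (node (r (x t))) with ht'
  obtain ⟨y, hy⟩ : (B t ∩ B t').Nonempty := by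
    rw [← Finset.card_pos]
    have h1 := Finset.card_union_add_card_inter (B t) (B t')
    have h2 := Finset.card_le_univ (B t ∪ B t')
    have := hcard t
    have := hcard t'
    omega
  rw [Finset.mem_inter] at hy
  refine D.isTree.next_next_ne (hnode_ne t y hy.1) (hnode_ne t' y hy.2) (t' := t') ?_ ?_
  · exact (D.next_eq_of_joinedWithin (hconn t _ (hx t) y hy.1) (hB t _ (hx t))
      (hnode _) (hnode _)).symm
  · rw [← D.next_eq_of_joinedWithin (hconn t' _ (hx t') y hy.2) (hB t' _ (hx t'))
      (hnode _) (hnode _)]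
    exact ht

end TreeDecomposition

/-- A set of marked points of which any `s` vertices fail to separate the majority forces the
treewidth to be at least `s`. -/
theorem le_treewidth_of_majority {V : Type*} [Finite V] {G : SimpleGraph V} {M : Type*}
    [Fintype M] (r : M → V) (s : ℕ)
    (h : ∀ S : Finset V, S.card ≤ s → ∃ B : Finset M, Fintype.card M < 2 * B.card ∧
      (∀ x ∈ B, r x ∉ S) ∧ ∀ x ∈ B, ∀ y ∈ B, G.JoinedWithin (S : Set V)ᶜ (r x) (r y)) :
    s ≤ treewidth G := by
  obtain ⟨m, D, hD⟩ := exists_treeDecomposition_width_eq G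
  obtain ⟨t, ht⟩ := D.exists_lt_card_bag r s h
  have := Finset.le_sup (f := fun i => (D.bag i).card) (Finset.mem_univ t)
  rw [← hD, TreeDecomposition.width]
  exact Nat.le_sub_one_of_lt (ht.trans_le this)

/-! ### Routes in a finite group. -/

/-- A group element `y` has a route of cost `d` for the relation `adj` if all translates of the
pair `(1, y)` can be joined by `adj`-chains through the translates of a set of `d` elements. -/
def HasRoute {Γ : Type*} [Group Γ] (adj : Γ → Γ → Prop) (d : ℕ) (y : Γ) : Prop :=
  ∃ P : Finset Γ, P.card ≤ d ∧ ∀ (K : Set Γ) (g : Γ), (∀ z ∈ P, g * z ∉ K) →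
    Relation.ReflTransGen (fun a b => a ∉ K ∧ b ∉ K ∧ adj a b) g (g * y)

namespace HasRoute

variable {Γ : Type*} [Group Γ] {adj : Γ → Γ → Prop} {d e : ℕ} {x y : Γ}

theorem mono (h : HasRoute adj d x) (hde : d ≤ e) : HasRoute adj e x := by
  obtain ⟨P, hP, h⟩ := h
  exact ⟨P, hP.trans hde, h⟩

theorem one : HasRoute adj d (1 : Γ) :=
  ⟨∅, by simp, fun K g _ => by rw [mul_one]⟩

theorem of_adj (h : ∀ g, adj g (g * x)) : HasRoute adj 2 x := by
  classical
  refine ⟨{1, x}, Finset.card_le_two, fun K g hg => .single ⟨?_, ?_, h g⟩⟩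
  · simpa using hg 1 (by simp)
  · exact hg x (by simp)

theorem mul (hx : HasRoute adj d x) (hy : HasRoute adj e y) : HasRoute adj (d + e) (x * y) := by
  classical
  obtain ⟨P, hP, hx⟩ := hx
  obtain ⟨Q, hQ, hy⟩ := hy
  refine ⟨P ∪ Q.image (x * ·), ?_, fun K g hg => ?_⟩
  · exact (Finset.card_union_le _ _).trans
      (Nat.add_le_add hP (Finset.card_image_le.trans hQ))
  · refine (hx K g fun z hz => hg z (Finset.mem_union_left _ hz)).trans ?_
    rw [← mul_assoc]
    refine hy K (g * x) fun z hz => ?_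
    rw [mul_assoc]
    exact hg _ (Finset.mem_union_right _ (Finset.mem_image_of_mem _ hz))

end HasRoute

/-- Deleting a small set from a finite group in which all elements have short routes leaves
a majority of the elements joined to each other. -/
theorem exists_majority_of_hasRoute {Γ : Type*} [Group Γ] [Fintype Γ] {adj : Γ → Γ → Prop}
    {d : ℕ} (h : ∀ y, HasRoute adj d y) (K : Finset Γ)
    (hK : 2 * (d + 1) * K.card < Fintype.card Γ) :
    ∃ (g : Γ) (B : Finset Γ), Fintype.card Γ < 2 * B.card ∧ ∀ y ∈ B, y ∉ K ∧
      Relation.ReflTransGen (fun a b => a ∉ K ∧ b ∉ K ∧ adj a b) g y := by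
  classical
  choose P hP hroute using h
  let Q : Γ → Finset Γ := fun y => insert y (P y)
  have hQ : ∀ y, (Q y).card ≤ d + 1 := fun y =>
    (Finset.card_insert_le _ _).trans (Nat.succ_le_succ (hP y))
  let bad : Γ → Γ → Prop := fun g y => ∃ z ∈ Q y, g * z ∈ K
  have hbad : ∀ y, (Finset.univ.filter fun g => bad g y).card ≤ (d + 1) * K.card := fun y => by
    have hsub : (Finset.univ.filter fun g => bad g y) ⊆
        (Q y).biUnion fun z => K.image (· * z⁻¹) := by
      intro g hg
      obtain ⟨z, hz, hgz⟩ := (Finset.mem_filter.1 hg).2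
      exact Finset.mem_biUnion.2 ⟨z, hz, Finset.mem_image.2 ⟨g * z, hgz, by simp⟩⟩
    exact (Finset.card_le_card hsub).trans ((Finset.card_biUnion_le_card_mul _ _ _
      fun z _ => Finset.card_image_le).trans (Nat.mul_le_mul_right _ (hQ y)))
  -- Each route is spoiled by at most (d + 1)|K| starting points, so by double counting some
  -- starting point spoils at most that many routes, less than half of them.
  obtain ⟨g, -, hg⟩ : ∃ g ∈ (Finset.univ : Finset Γ),
      (Finset.univ.filter fun y => bad g y).card ≤ (d + 1) * K.card := by
    refine Finset.exists_le_of_sum_le Finset.univ_nonempty ?_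
    have := Finset.sum_card_bipartiteAbove_eq_sum_card_bipartiteBelow
      (s := (Finset.univ : Finset Γ)) (t := Finset.univ) bad
    simp only [Finset.bipartiteAbove, Finset.bipartiteBelow] at this
    rw [this]
    exact Finset.sum_le_sum fun y _ => hbad y
  let good : Finset Γ := Finset.univ.filter fun y => ¬ bad g y
  have hgood : Fintype.card Γ < 2 * good.card := by
    have := Finset.card_filter_add_card_filter_not (s := (Finset.univ : Finset Γ))
      (fun y => bad g y)
    rw [Finset.card_univ] at this
    simp only [good]
    rw [mul_assoc] at hK
    omega
  have key : ∀ y ∈ good, ∀ z ∈ Q y, g * z ∉ K := fun y hy z hz hmem =>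
    (Finset.mem_filter.1 hy).2 ⟨z, hz, hmem⟩
  refine ⟨g, good.image (g * ·), ?_, fun y hy => ?_⟩
  · rwa [Finset.card_image_of_injective _ (mul_right_injective g)]
  · obtain ⟨y, hy', rfl⟩ := Finset.mem_image.1 hy
    exact ⟨key y hy' y (by simp [Q]), hroute y K g fun z hz => key y hy' z (by simp [Q, hz])⟩

/-! ### Connectivity of configurations confined to fibres. -/

open Equiv

/-- If the fibres of `f` have one element or at least three, the configurations in which each disk
`i` stays on the pegs of the fibre `f ⁻¹' {c i}` are connected within the Hanoi graph. -/
theorem hanoiGraph_joinedWithin {p n : ℕ} (f : Fin p → Fin p) (c : Fin n → Fin p)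
    (hf : ∀ a b, a ≠ b → f a = f b → ∃ d, d ≠ a ∧ d ≠ b ∧ f d = f a) {u v : Fin n → Fin p}
    (hu : ∀ i, f (u i) = c i) (hv : ∀ i, f (v i) = c i) :
    (hanoiGraph p n).JoinedWithin {w | ∀ i, f (w i) = c i} u v := by
  suffices H : ∀ m : ℕ, ∀ u v : Fin n → Fin p, (∀ i, f (u i) = c i) → (∀ i, f (v i) = c i) →
      (∀ i : Fin n, m ≤ i → u i = v i) →
      (hanoiGraph p n).JoinedWithin {w | ∀ i, f (w i) = c i} u v from
    H n u v hu hv fun i hi => absurd i.2 (not_lt.2 hi)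
  intro m
  induction m with
  | zero =>
    intro u v _ _ h
    rw [funext fun i => h i (Nat.zero_le _)]
    exact .refl
  | succ m ih =>
    intro u v hu hv h
    rcases le_or_gt n m with hm | hm
    · exact ih u v hu hv fun i hi => absurd i.2 (not_lt.2 (hm.trans hi))
    let j : Fin n := ⟨m, hm⟩
    have hlt : ∀ i : Fin n, m ≤ i → i ≠ j → m + 1 ≤ i := fun i hi hij =>
      Nat.lt_of_le_of_ne hi fun e => hij (Fin.ext e.symm)
    by_cases huv : u j = v j
    · refine ih u v hu hv fun i hi => ?_
      by_cases hij : i = j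
      · rw [hij, huv]
      · exact h i (hlt i hi hij)
    obtain ⟨d, hda, hdb, hd⟩ := hf (u j) (v j) huv (by rw [hu, hv])
    -- To move disk `j`, first gather the smaller disks of its fibre on the third peg `d`; smaller
    -- disks of other fibres are never in the way.
    let u' : Fin n → Fin p := fun i => if i < j ∧ f (u i) = f (u j) then d else u i
    have hu'j : u' j = u j := by simp [u']
    have hu' : ∀ i, f (u' i) = c i := fun i => by
      by_cases hi : i < j ∧ f (u i) = f (u j)
      · rw [show u' i = d from if_pos hi, hd, ← hi.2, hu]
      · rw [show u' i = u i from if_neg hi, hu]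
    let u'' := Function.update u' j (v j)
    have hu''j : u'' j = v j := by simp [u'']
    have hu''i : ∀ i, i ≠ j → u'' i = u' i := fun i hi => by simp [u'', hi]
    have hu'' : ∀ i, f (u'' i) = c i := fun i => by
      by_cases hi : i = j
      · rw [hi, hu''j, hv]
      · rw [hu''i i hi, hu']
    have hge : ∀ i, ¬ i < j → u' i = u i := fun i hi => by simp [u', hi]
    refine (ih u u' hu hu' fun i hi => (hge i (not_lt.2 hi)).symm).trans
      (.head ⟨⟨j, ?_, fun i hi => (hu''i i hi).symm, fun i hi => ?_⟩, hu', hu''⟩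
        (ih u'' v hu'' hv fun i hi => ?_))
    · rwa [hu'j, hu''j]
    · rw [hu'j, hu''j]
      by_cases hfi : f (u i) = f (u j)
      · simp only [u', hi, hfi, and_self, if_true]
        exact ⟨hda, hdb⟩
      · simp only [u', hi, hfi, and_false, if_false]
        exact ⟨fun e => hfi (by rw [e]), fun e => hfi (by rw [e, hu, hv])⟩
    · by_cases hij : i = j
      · rw [hij, hu''j]
      · rw [hu''i i hij, hge i (not_lt.2 hi), h i (hlt i hi hij)]

/-- A homomorphism from a symmetric group takes all values at bounded cost if it does so on
transpositions. -/
theorem HasRoute.of_swap {α Γ : Type*} [Fintype α] [DecidableEq α] [Group Γ] {adj : Γ → Γ → Prop}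
    {d : ℕ} (φ : Perm α →* Γ) (h : ∀ x y, x ≠ y → HasRoute adj d (φ (swap x y))) (σ : Perm α) :
    HasRoute adj (Fintype.card α * d) (φ σ) := by
  suffices H : ∀ m, ∀ σ : Perm α, σ.support.card ≤ m → HasRoute adj (m * d) (φ σ) from
    H _ σ (Finset.card_le_univ _)
  intro m
  induction m with
  | zero =>
    intro σ hσ
    rw [Perm.support_eq_empty_iff.1 (Finset.card_eq_zero.1 (Nat.le_zero.1 hσ)), map_one]
    exact .one
  | succ m ih =>
    intro σ hσ
    by_cases h1 : σ = 1
    · rw [h1, map_one]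
      exact .one
    obtain ⟨x, hx⟩ : ∃ x, σ x ≠ x := by
      by_contra! hall
      exact h1 (Equiv.ext hall)
    have := Perm.card_support_swap_mul hx
    have key := (h x (σ x) hx.symm).mul (ih (swap x (σ x) * σ) (by omega))
    rw [← map_mul, ← mul_assoc, swap_mul_self, one_mul] at key
    exact key.mono (by rw [add_mul, one_mul, add_comm])

/-! ### Translates of the base set, and routes between them. -/

section Translates

variable {α β : Type*}

/-- The translate by a pair of permutations of the set of maps `v : α → β` with `ρ ∘ v = c`. -/
def permTranslate (ρ : β → β) (c : α → β) (g : Perm α × Perm β) : Set (α → β) :=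
  {v | ∀ i, ρ (g.2⁻¹ (v (g.1 i))) = c i}

/-- Two translates meet. -/
def TranslatesMeet (ρ : β → β) (c : α → β) (g h : Perm α × Perm β) : Prop :=
  (permTranslate ρ c g ∩ permTranslate ρ c h).Nonempty

/-- Left translation by `g` carries the common point `v` of the base set and its translate by `h` to
a common point of the translates by `g` and `g * h`. -/
theorem hasRoute_of_mem_permTranslate {ρ : β → β} {c : α → β} {h : Perm α × Perm β} {v : α → β}
    (h1 : ∀ i, ρ (v i) = c i) (h2 : v ∈ permTranslate ρ c h) :
    HasRoute (TranslatesMeet ρ c) 2 h := by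
  refine .of_adj fun g => ⟨fun i => g.2 (v (g.1⁻¹ i)), fun i => ?_, fun i => ?_⟩
  · simpa using h1 i
  · simpa using h2 i

variable [DecidableEq β]

/-- The map collapsing `P` to the point `b₀`. -/
def collapseTo (P : Finset β) (b₀ b : β) : β := if b ∈ P then b₀ else b

theorem collapseTo_of_mem {P : Finset β} {b₀ b : β} (h : b ∈ P) : collapseTo P b₀ b = b₀ := if_pos h

theorem collapseTo_of_notMem {P : Finset β} {b₀ b : β} (h : b ∉ P) : collapseTo P b₀ b = b := if_neg h

variable [Fintype α]

/-- A colouring whose colours are `b₀ ∈ P` and the elements outside `P`, such that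
each colour class other than that of `b₀` has `k` elements, and that of `b₀` has more. -/
structure IsBalancedColoring (P : Finset β) (b₀ : β) (k : ℕ) (c : α → β) : Prop where
  mem : b₀ ∈ P
  two_lt_card : 2 < P.card
  eq_or_notMem : ∀ i, c i = b₀ ∨ c i ∉ P
  card_eq : ∀ a ∉ P, (Finset.univ.filter fun i => c i = a).card = k
  lt_card : k < (Finset.univ.filter fun i => c i = b₀).card

namespace IsBalancedColoring

variable {P : Finset β} {b₀ : β} {k : ℕ} {c : α → β}

theorem ne (hc : IsBalancedColoring P b₀ k c) {a : β} (ha : a ∉ P) : a ≠ b₀ :=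
  fun e => ha (e ▸ hc.mem)

theorem collapseTo_apply (hc : IsBalancedColoring P b₀ k c) (i : α) :
    collapseTo P b₀ (c i) = c i := by
  rcases hc.eq_or_notMem i with h | h
  · rw [h, collapseTo_of_mem hc.mem]
  · exact collapseTo_of_notMem h

theorem hasRoute_of_comp_eq (hc : IsBalancedColoring P b₀ k c) {τ : Perm α} {π : Perm β}
    (hτ : ∀ i, c (τ i) = c i) (hπ : ∀ b, collapseTo P b₀ (π⁻¹ b) = collapseTo P b₀ b) :
    HasRoute (TranslatesMeet (collapseTo P b₀) c) 2 (τ, π) :=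
  hasRoute_of_mem_permTranslate hc.collapseTo_apply fun i => by
    simp only
    rw [hπ, hτ, hc.collapseTo_apply]

/-- This is the basic exchange of a parked class with part of the roaming class, made possible by
swapping their pegs at the same time. -/
theorem hasRoute_involution (hc : IsBalancedColoring P b₀ k c) {a b : β} (ha : a ∉ P) (hb : b ∈ P)
    {τ : Perm α} (h1 : ∀ i, τ (τ i) = i) (h2 : ∀ i, c i = a → c (τ i) = b₀)
    (h3 : ∀ i, c i ≠ a → c (τ i) = a ∨ τ i = i) :
    HasRoute (TranslatesMeet (collapseTo P b₀) c) 2 (τ, swap a b) := by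
  have hne := hc.ne ha
  obtain ⟨b', hb', hbb'⟩ := Finset.exists_mem_ne (by have := hc.two_lt_card; omega : 1 < P.card) b
  let v : α → β := fun i => if c i = b₀ then (if c (τ i) = a then b else b') else c i
  refine hasRoute_of_mem_permTranslate (v := v) (fun i => ?_) fun i => ?_
  · by_cases hi : c i = b₀
    · simp only [v, if_pos hi]
      split_ifs
      · rw [collapseTo_of_mem hb, hi]
      · rw [collapseTo_of_mem hb', hi]
    · simp only [v, if_neg hi, hc.collapseTo_apply]
  · simp only [swap_inv]
    by_cases hia : c i = a
    · have : v (τ i) = b := by simp only [v, if_pos (h2 i hia), h1, if_pos hia]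
      rw [this, swap_apply_right, hia, collapseTo_of_notMem ha]
    rcases h3 i hia with hi | hi
    · have : v (τ i) = a := by simp only [v, hi, if_neg hne]
      rw [this, swap_apply_left, collapseTo_of_mem hb]
      by_contra hib
      have := h2 (τ i) hi
      rw [h1] at this
      exact hib this.symm
    · rw [hi]
      by_cases hib : c i = b₀
      · have : v i = b' := by simp only [v, hi, if_pos hib, if_neg hia]
        rw [this, swap_apply_of_ne_of_ne (ne_of_mem_of_not_mem hb' ha) hbb', collapseTo_of_mem hb', hib]
      · have : v i = c i := by simp only [v, if_neg hib]
        have hiP := (hc.eq_or_notMem i).resolve_left hib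
        rw [this, swap_apply_of_ne_of_ne hia (fun e => hiP (e ▸ hb)), hc.collapseTo_apply]

end IsBalancedColoring

variable [DecidableEq α]

/-- A vertex lies in few permuted copies. -/
theorem card_filter_mem_permTranslate_le [Fintype β] (ρ : β → β) (c v : α → β)
    [DecidablePred fun g : Perm α × Perm β => v ∈ permTranslate ρ c g] :
    (Finset.univ.filter fun g : Perm α × Perm β => v ∈ permTranslate ρ c g).card ≤
      (∏ b, (Fintype.card {i // c i = b}).factorial) * (Fintype.card β).factorial := by
  classical
  refine (Finset.card_le_mul_card_image (f := Prod.snd) _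
    (∏ b, (Fintype.card {i // c i = b}).factorial) ?_).trans
    (Nat.mul_le_mul_left _ ((Finset.card_le_univ _).trans_eq Fintype.card_perm))
  intro π hπ
  -- For a fixed peg permutation, the disk permutations that work differ from that of `g₀` by a
  -- permutation preserving `c`.
  obtain ⟨g₀, hg₀, rfl⟩ := Finset.mem_image.1 hπ
  have hg₀ := (Finset.mem_filter.1 hg₀).2
  rw [← DomMulAct.stabilizer_card, Fintype.card_subtype]
  refine Finset.card_le_card_of_injOn (fun g => g₀.1⁻¹ * g.1) ?_ ?_
  · intro g hg
    simp only [Finset.coe_filter, Finset.mem_filter, Finset.mem_univ, true_and,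
      Set.mem_ofPred_eq] at hg ⊢
    funext i
    have e1 := hg.1 i
    have e2 := hg₀ ((g₀.1⁻¹ * g.1) i)
    rw [hg.2] at e1
    simp only [Perm.mul_apply, Perm.inv_def, Equiv.apply_symm_apply] at e2
    simp only [Function.comp_apply, Perm.mul_apply]
    exact e2.symm.trans e1
  · intro g hg g' hg' e
    simp only [Finset.coe_filter, Finset.mem_filter, Finset.mem_univ, true_and,
      Set.mem_ofPred_eq] at hg hg'
    exact Prod.ext (mul_left_cancel e) (hg.2.trans hg'.2.symm)

namespace IsBalancedColoring

variable {P : Finset β} {b₀ : β} {k : ℕ} {c : α → β}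

/-- There is an involution that maps the class of `a` into that of `b₀`, and fixes all
remaining elements, one of which has colour `b₀`. -/
theorem exists_involution (hc : IsBalancedColoring P b₀ k c) {a : β} (ha : a ∉ P) :
    ∃ τ : Perm α, (∀ i, τ (τ i) = i) ∧ (∀ i, c i = a → c (τ i) = b₀) ∧
      (∀ i, c i ≠ a → c (τ i) = a ∨ τ i = i) ∧ ∃ z, c z = b₀ ∧ τ z = z := by
  have hne := hc.ne ha
  set A := Finset.univ.filter fun i => c i = a with hA
  obtain ⟨B, hB, hcard⟩ := Finset.exists_subset_card_eq hc.lt_card.le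
  let e : A ≃ B := Finset.equivOfCardEq ((hc.card_eq a ha).trans hcard.symm)
  have hAa : ∀ i, i ∈ A ↔ c i = a := fun i => by simp [hA]
  have hBb : ∀ i, i ∈ B → c i = b₀ := fun i hi => by simpa using hB hi
  have hBA : ∀ i, i ∈ B → i ∉ A := fun i hi hi' => hne (((hAa i).1 hi').symm.trans (hBb i hi))
  let t : α → α := fun i =>
    if h : i ∈ A then (e ⟨i, h⟩ : α) else if h : i ∈ B then (e.symm ⟨i, h⟩ : α) else i
  have tA : ∀ i (h : i ∈ A), t i = e ⟨i, h⟩ := fun i h => dif_pos h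
  have tB : ∀ i (h : i ∈ B), t i = e.symm ⟨i, h⟩ := fun i h =>
    (dif_neg (hBA i h)).trans (dif_pos h)
  have tN : ∀ i, i ∉ A → i ∉ B → t i = i := fun i h h' => (dif_neg h).trans (dif_neg h')
  have ht : Function.Involutive t := fun i => by
    by_cases h : i ∈ A
    · rw [tA i h, tB _ (e ⟨i, h⟩).2]; simp
    by_cases h' : i ∈ B
    · rw [tB i h', tA _ (e.symm ⟨i, h'⟩).2]; simp
    · rw [tN i h h', tN i h h']
  -- The roaming class is strictly larger, which leaves a disk that the involution fixes.
  obtain ⟨z, hz, hzB⟩ := Finset.exists_mem_notMem_of_card_lt_card (hcard.trans_lt hc.lt_card)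
  have hz : c z = b₀ := by simpa using hz
  refine ⟨ht.toPerm, ht, fun i hi => ?_, fun i hi => ?_, z, hz, ?_⟩
  · change c (t i) = b₀
    rw [tA i ((hAa i).2 hi)]
    exact hBb _ (e _).2
  · change c (t i) = a ∨ t i = i
    have hiA : i ∉ A := fun h => hi ((hAa i).1 h)
    by_cases hiB : i ∈ B
    · left
      rw [tB i hiB]
      exact (hAa _).1 (e.symm _).2
    · exact Or.inr (tN i hiA hiB)
  · exact tN z (fun h => hne (((hAa z).1 h).symm.trans hz)) hzB

theorem hasRoute_swap_of_eq (hc : IsBalancedColoring P b₀ k c) {x y : α} (h : c x = c y) :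
    HasRoute (TranslatesMeet (collapseTo P b₀) c) 2 (swap x y, 1) :=
  hc.hasRoute_of_comp_eq (fun i => by
    rcases eq_or_ne i x with rfl | hx
    · rw [swap_apply_left, h]
    rcases eq_or_ne i y with rfl | hy
    · rw [swap_apply_right, h]
    rw [swap_apply_of_ne_of_ne hx hy]) fun b => by simp

theorem hasRoute_swap_of_free (hc : IsBalancedColoring P b₀ k c) {x y : α} (hx : c x ∉ P)
    (hy : c y = b₀) : HasRoute (TranslatesMeet (collapseTo P b₀) c) 10 (swap x y, 1) := by
  obtain ⟨τ, h1, h2, h3, z, hz, hτz⟩ := hc.exists_involution hx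
  have hτ : τ⁻¹ = τ := by
    ext i
    rw [Perm.inv_eq_iff_eq, h1]
  have hE := hc.hasRoute_involution hx hc.mem h1 h2 h3
  -- Conjugating the swap of the roaming disks `τ x` and `z` by the exchange gives the swap of `x`
  -- and `z`, and the two peg swaps cancel.
  have hxz : HasRoute (TranslatesMeet (collapseTo P b₀) c) 6 (swap x z, 1) := by
    have := (hE.mul (hc.hasRoute_swap_of_eq ((h2 x rfl).trans hz.symm))).mul hE
    simp only [Prod.mk_mul_mk, mul_one, swap_mul_self] at this
    rwa [show τ * swap (τ x) z * τ = swap x z by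
      nth_rw 3 [← hτ]
      rw [← swap_apply_apply, h1, hτz]] at this
  by_cases hyz : y = z
  · exact (hyz ▸ hxz).mono (by norm_num)
  have hzy := hc.hasRoute_swap_of_eq (hz.trans hy.symm)
  have := (hzy.mul hxz).mul hzy
  simp only [Prod.mk_mul_mk, mul_one] at this
  rwa [swap_mul_swap_mul_swap (fun e : x = z => hc.ne hx (e ▸ hz)) (fun e : x = y => hc.ne hx (e ▸ hy)),
    swap_comm] at this

theorem hasRoute_swap (hc : IsBalancedColoring P b₀ k c) (x y : α) :
    HasRoute (TranslatesMeet (collapseTo P b₀) c) 30 (swap x y, 1) := by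
  by_cases hxy : c x = c y
  · exact (hc.hasRoute_swap_of_eq hxy).mono (by norm_num)
  rcases hc.eq_or_notMem x with hx | hx
  · have hy := (hc.eq_or_notMem y).resolve_left fun e => hxy (hx.trans e.symm)
    rw [swap_comm]
    exact (hc.hasRoute_swap_of_free hy hx).mono (by norm_num)
  rcases hc.eq_or_notMem y with hy | hy
  · exact (hc.hasRoute_swap_of_free hx hy).mono (by norm_num)
  obtain ⟨z, hz⟩ := Finset.card_pos.1 ((Nat.zero_le _).trans_lt hc.lt_card)
  have hz : c z = b₀ := by simpa using hz
  have hyz := hc.hasRoute_swap_of_free hy hz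
  have := (hyz.mul (hc.hasRoute_swap_of_free hx hz)).mul hyz
  simp only [Prod.mk_mul_mk, mul_one] at this
  rwa [swap_comm y z, swap_mul_swap_mul_swap (fun e : x = z => hc.ne hx (e ▸ hz))
    (fun e : x = y => hxy (e ▸ rfl)), swap_comm] at this

theorem hasRoute_fst (hc : IsBalancedColoring P b₀ k c) (τ : Perm α) :
    HasRoute (TranslatesMeet (collapseTo P b₀) c) (Fintype.card α * 30) (τ, 1) :=
  HasRoute.of_swap (MonoidHom.inl (Perm α) (Perm β)) (fun x y _ => hc.hasRoute_swap x y) τ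

/-- An exchange swaps the two pegs; its effect on disks is undone by a pure disk permutation. -/
theorem hasRoute_swap_snd_of_mem (hc : IsBalancedColoring P b₀ k c) {a b : β} (ha : a ∉ P)
    (hb : b ∈ P) : HasRoute (TranslatesMeet (collapseTo P b₀) c) (Fintype.card α * 30 + 2)
      ((1 : Perm α), swap a b) := by
  obtain ⟨τ, h1, h2, h3, -⟩ := hc.exists_involution ha
  have := (hc.hasRoute_fst τ⁻¹).mul (hc.hasRoute_involution ha hb h1 h2 h3)
  rwa [Prod.mk_mul_mk, inv_mul_cancel, one_mul] at this

theorem hasRoute_swap_snd (hc : IsBalancedColoring P b₀ k c) {a b : β} (hab : a ≠ b) :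
    HasRoute (TranslatesMeet (collapseTo P b₀) c) (3 * (Fintype.card α * 30 + 2))
      ((1 : Perm α), swap a b) := by
  by_cases ha : a ∈ P
  · by_cases hb : b ∈ P
    · refine (hc.hasRoute_of_comp_eq (fun _ => rfl) fun d => ?_).mono (by omega)
      rw [swap_inv]
      rcases eq_or_ne d a with rfl | hda
      · rw [swap_apply_left, collapseTo_of_mem ha, collapseTo_of_mem hb]
      rcases eq_or_ne d b with rfl | hdb
      · rw [swap_apply_right, collapseTo_of_mem ha, collapseTo_of_mem hb]
      rw [swap_apply_of_ne_of_ne hda hdb]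
    · rw [swap_comm]
      exact (hc.hasRoute_swap_snd_of_mem hb ha).mono (by omega)
  by_cases hb : b ∈ P
  · exact (hc.hasRoute_swap_snd_of_mem ha hb).mono (by omega)
  have hb' := hc.hasRoute_swap_snd_of_mem hb hc.mem
  have := (hb'.mul (hc.hasRoute_swap_snd_of_mem ha hc.mem)).mul hb'
  simp only [Prod.mk_mul_mk, mul_one] at this
  rw [swap_comm b b₀, swap_mul_swap_mul_swap (hc.ne ha) hab, swap_comm] at this
  exact this.mono (by omega)

/-- Every pair of permutations has a route whose cost is linear in the number of disks. -/
theorem hasRoute [Fintype β] (hc : IsBalancedColoring P b₀ k c) (g : Perm α × Perm β) :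
    HasRoute (TranslatesMeet (collapseTo P b₀) c)
      (Fintype.card α * 30 + Fintype.card β * (3 * (Fintype.card α * 30 + 2))) g := by
  have := (hc.hasRoute_fst g.1).mul (HasRoute.of_swap (MonoidHom.inr (Perm α) (Perm β))
    (fun a b hab => hc.hasRoute_swap_snd hab) g.2)
  simpa using this

end IsBalancedColoring

end Translates

/-! ### From balanced colourings to treewidth. -/

theorem collapseTo_exists_third {p : ℕ} {P : Finset (Fin p)} {b₀ : Fin p} (hb₀ : b₀ ∈ P)
    (hP : 2 < P.card) (a b : Fin p) (hab : a ≠ b) (h : collapseTo P b₀ a = collapseTo P b₀ b) :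
    ∃ d, d ≠ a ∧ d ≠ b ∧ collapseTo P b₀ d = collapseTo P b₀ a := by
  have ha : a ∈ P := by
    by_contra ha
    rw [collapseTo_of_notMem ha] at h
    by_cases hb : b ∈ P
    · rw [collapseTo_of_mem hb] at h
      exact ha (h ▸ hb₀)
    · exact hab (h.trans (collapseTo_of_notMem hb))
  obtain ⟨d, hd, hd'⟩ := Finset.exists_mem_notMem_of_card_lt_card
    (s := {a, b}) (t := P) (Finset.card_le_two.trans_lt hP)
  simp only [Finset.mem_insert, Finset.mem_singleton, not_or] at hd'
  exact ⟨d, hd'.1, hd'.2, by rw [collapseTo_of_mem hd, collapseTo_of_mem ha]⟩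

theorem hanoiGraph_joinedWithin_permTranslate {p n : ℕ} {P : Finset (Fin p)} {b₀ : Fin p}
    (hb₀ : b₀ ∈ P) (hP : 2 < P.card) (c : Fin n → Fin p) (g : Perm (Fin n) × Perm (Fin p))
    {u v : Fin n → Fin p} (hu : u ∈ permTranslate (collapseTo P b₀) c g)
    (hv : v ∈ permTranslate (collapseTo P b₀) c g) :
    (hanoiGraph p n).JoinedWithin (permTranslate (collapseTo P b₀) c g) u v := by
  have hset : permTranslate (collapseTo P b₀) c g =
      {w | ∀ i, collapseTo P b₀ (g.2⁻¹ (w i)) = c (g.1⁻¹ i)} := by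
    ext w
    exact ⟨fun h i => by simpa using h (g.1⁻¹ i), fun h i => by simpa using h (g.1 i)⟩
  rw [hset] at hu hv ⊢
  refine hanoiGraph_joinedWithin (fun b => collapseTo P b₀ (g.2⁻¹ b)) _ (fun a b hab h => ?_)
    hu hv
  obtain ⟨d, hda, hdb, hd⟩ := collapseTo_exists_third hb₀ hP (g.2⁻¹ a) (g.2⁻¹ b)
    (fun e => hab (g.2⁻¹.injective e)) h
  exact ⟨g.2 d, fun e => hda (by simp [← e]), fun e => hdb (by simp [← e]), by simpa using hd⟩

/-- The treewidth bound given by a balanced colouring. -/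
theorem IsBalancedColoring.le_treewidth {p n : ℕ} {P : Finset (Fin p)} {b₀ : Fin p} {k : ℕ}
    {c : Fin n → Fin p} (hc : IsBalancedColoring P b₀ k c) (s : ℕ)
    (hs : 2 * (n * 30 + p * (3 * (n * 30 + 2)) + 1) *
      (s * ∏ b, (Fintype.card {i // c i = b}).factorial) < n.factorial) :
    s ≤ treewidth (hanoiGraph p n) := by
  classical
  refine le_treewidth_of_majority
    (fun (g : Perm (Fin n) × Perm (Fin p)) i => g.2 (c (g.1⁻¹ i))) s fun S hS => ?_
  set ρ := collapseTo P b₀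
  have hrep : ∀ g : Perm (Fin n) × Perm (Fin p),
      (fun i => g.2 (c (g.1⁻¹ i))) ∈ permTranslate ρ c g := fun g i => by
    simpa using hc.collapseTo_apply i
  set K : Finset (Perm (Fin n) × Perm (Fin p)) :=
    S.biUnion fun v => Finset.univ.filter fun g => v ∈ permTranslate ρ c g
  have hK : ∀ g ∉ K, permTranslate ρ c g ⊆ (S : Set (Fin n → Fin p))ᶜ := fun g hg v hv hvS =>
    hg (Finset.mem_biUnion.2 ⟨v, hvS, Finset.mem_filter.2 ⟨Finset.mem_univ _, hv⟩⟩)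
  have hKcard : K.card ≤ s * ((∏ b, (Fintype.card {i // c i = b}).factorial) * p.factorial) :=
    (Finset.card_biUnion_le_card_mul _ _ _ fun v _ => by
      simpa using card_filter_mem_permTranslate_le ρ c v).trans (Nat.mul_le_mul_right _ hS)
  obtain ⟨g, B, hB, hBg⟩ := exists_majority_of_hasRoute hc.hasRoute K (by
    rw [Fintype.card_prod, Fintype.card_perm, Fintype.card_perm, Fintype.card_fin,
      Fintype.card_fin]
    refine (Nat.mul_le_mul_left _ hKcard).trans_lt ?_
    rw [← mul_assoc s, ← mul_assoc]
    exact Nat.mul_lt_mul_of_pos_right hs (Nat.factorial_pos p))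
  have hjoin : ∀ h ∈ B, (hanoiGraph p n).JoinedWithin (S : Set (Fin n → Fin p))ᶜ
      (fun i => g.2 (c (g.1⁻¹ i))) (fun i => h.2 (c (h.1⁻¹ i))) := fun h hh => by
    have hgh := (hBg h hh).2
    clear hh
    induction hgh with
    | refl => exact .refl
    | tail _ hstep ih =>
      obtain ⟨hx, hy, w, hwx, hwy⟩ := hstep
      exact ih.trans (((hanoiGraph_joinedWithin_permTranslate hc.mem hc.two_lt_card c _
        (hrep _) hwx).mono (hK _ hx)).trans ((hanoiGraph_joinedWithin_permTranslate hc.mem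
          hc.two_lt_card c _ hwy (hrep _)).mono (hK _ hy)))
  exact ⟨B, hB, fun x hx => hK x (hBg x hx).1 (hrep x), fun x hx y hy =>
    (hjoin x hx).symm.trans (hjoin y hy)⟩

theorem exists_isBalancedColoring {q k m n : ℕ} (hn : n = q * k + m) (hkm : k < m) :
    ∃ (P : Finset (Fin (3 + q))) (b₀ : Fin (3 + q)) (c : Fin n → Fin (3 + q)),
      IsBalancedColoring P b₀ k c ∧
      ∏ b, (Fintype.card {i // c i = b}).factorial = m.factorial * k.factorial ^ q := by
  have e : Fin n ≃ (Fin q × Fin k) ⊕ Fin m := Fintype.equivOfCardEq (by simp [hn])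
  let g : (Fin q × Fin k) ⊕ Fin m → Fin (3 + q) :=
    Sum.elim (fun x => Fin.natAdd 3 x.1) fun _ => Fin.castAdd q 0
  have hne : ∀ (i : Fin 3) (j : Fin q), Fin.castAdd q i ≠ Fin.natAdd 3 j := fun i j =>
    Fin.ne_of_val_ne (by simp only [Fin.val_castAdd, Fin.val_natAdd]; omega)
  have hcard : ∀ b, (Finset.univ.filter fun i => g (e i) = b).card =
      (∑ x : Fin q, ∑ _ : Fin k, if Fin.natAdd 3 x = b then 1 else 0) +
        ∑ _ : Fin m, if Fin.castAdd q (0 : Fin 3) = b then 1 else 0 := fun b => by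
    rw [Finset.card_filter, e.sum_comp fun x => if g x = b then 1 else 0, Fintype.sum_sum_type,
      Fintype.sum_prod_type]
    rfl
  have hnat : ∀ j : Fin q, (Finset.univ.filter fun i => g (e i) = Fin.natAdd 3 j).card = k :=
    fun j => by
      rw [hcard]
      simp [hne, (Fin.natAdd_injective q 3).eq_iff]
  have hcast : ∀ j : Fin 3, (Finset.univ.filter fun i => g (e i) = Fin.castAdd q j).card =
      if j = 0 then m else 0 := fun j => by
    rw [hcard]
    simp [(hne _ _).symm, (Fin.castAdd_injective 3 q).eq_iff, eq_comm]
  refine ⟨Finset.univ.map (Fin.castAddEmb q), Fin.castAdd q 0, fun i => g (e i),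
    ⟨by simp, by simp, fun i => ?_, fun a ha => ?_, ?_⟩, ?_⟩
  · rcases e i with x | x
    · right
      simp [g, hne]
    · exact Or.inl rfl
  · induction a using Fin.addCases with
    | left j => simp at ha
    | right j => exact hnat j
  · rw [hcast, if_pos rfl]
    exact hkm
  · simp only [Fintype.card_subtype, Fin.prod_univ_add, hnat, hcast, Fin.prod_univ_three]
    simp

/-- A product of factorials with the multinomial sum `n = q * k + m` bounds the treewidth. -/
theorem factorial_le_treewidth_hanoiGraph {q k m n : ℕ} (hn : n = q * k + m) (hkm : k < m) :
    n.factorial ≤ (64 + 192 * (3 + q)) * n * ((treewidth (hanoiGraph (3 + q) n) + 1) *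
      (m.factorial * k.factorial ^ q)) := by
  obtain ⟨P, b₀, c, hc, hprod⟩ := exists_isBalancedColoring hn hkm
  by_contra! h
  have hn1 : 1 ≤ n := by omega
  refine absurd (hc.le_treewidth (treewidth (hanoiGraph (3 + q) n) + 1) ?_) (by omega)
  rw [hprod]
  refine lt_of_le_of_lt (Nat.mul_le_mul_right _ ?_) h
  nlinarith

/-! ### Asymptotics of the multinomial coefficient. -/

/-- Enlarging one class from `k` to `k + e` does not decrease the multinomial coefficient, so the
case of equal classes suffices. -/
theorem factorial_mul_factorial_add_le {r k e : ℕ} (hr : 2 ≤ r) (he : e ≤ k) :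
    (r * k).factorial * (k + e).factorial ≤ (r * k + e).factorial * k.factorial := by
  have h1 : (k + e).factorial ≤ k.factorial * (r * k) ^ e := by
    rw [← Nat.factorial_mul_ascFactorial]
    exact Nat.mul_le_mul_left _ ((Nat.ascFactorial_le_pow_add k e).trans
      (Nat.pow_le_pow_left (by nlinarith) _))
  have h2 : (r * k).factorial * (r * k) ^ e ≤ (r * k + e).factorial :=
    (Nat.mul_le_mul_left _ (Nat.pow_le_pow_left (Nat.le_succ _) _)).trans
      Nat.factorial_mul_pow_le_factorial
  calc (r * k).factorial * (k + e).factorial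
      ≤ (r * k).factorial * (k.factorial * (r * k) ^ e) := Nat.mul_le_mul_left _ h1
    _ = ((r * k).factorial * (r * k) ^ e) * k.factorial := by ring
    _ ≤ _ := Nat.mul_le_mul_right _ h2

theorem exists_factorial_le : ∃ A : ℝ, 0 < A ∧ ∀ k : ℕ, k ≠ 0 →
    (k.factorial : ℝ) ≤ A * √k * (k / Real.exp 1) ^ k := by
  refine ⟨Stirling.stirlingSeq 1 * √2, ?_, fun k hk => ?_⟩
  · have := Stirling.stirlingSeq'_pos 0
    positivity
  · obtain ⟨j, rfl⟩ := Nat.exists_eq_succ_of_ne_zero hk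
    have h := Stirling.stirlingSeq'_antitone (Nat.zero_le j)
    simp only [Function.comp_apply, Nat.succ_eq_add_one, zero_add] at h
    rw [Stirling.stirlingSeq, div_le_iff₀ (by positivity), Real.sqrt_mul (by norm_num)] at h
    calc _ ≤ _ := h
      _ = _ := by simp only [Nat.succ_eq_add_one]; ring

theorem sqrt_mul_pow_le_factorial (m : ℕ) : √m * (m / Real.exp 1) ^ m ≤ (m.factorial : ℝ) := by
  refine le_trans ?_ (Stirling.le_factorial_stirling m)
  gcongr
  nlinarith [Real.pi_gt_three, (Nat.cast_nonneg m : (0 : ℝ) ≤ m)]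

/-- The central multinomial coefficient is at least a constant times `r ^ (r k) / k ^ (q / 2)`,
where `r = q + 1`. -/
theorem exists_pow_mul_factorial_pow_le (q : ℕ) : ∃ A : ℝ, 0 < A ∧ ∀ k : ℕ, k ≠ 0 →
    ((q + 1 : ℝ)) ^ ((q + 1) * k) * (k.factorial : ℝ) ^ (q + 1) ≤
      A * √k ^ q * (((q + 1) * k).factorial : ℝ) := by
  obtain ⟨A, hA, h⟩ := exists_factorial_le
  refine ⟨A ^ (q + 1), by positivity, fun k hk => ?_⟩
  have hk' : (0 : ℝ) < k := by positivity
  have h1 := pow_le_pow_left₀ (by positivity) (h k hk) (q + 1)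
  have h2 := sqrt_mul_pow_le_factorial ((q + 1) * k)
  have h3 : √(k : ℝ) ≤ √(((q + 1) * k : ℕ) : ℝ) := by
    gcongr
    exact Nat.le_mul_of_pos_left _ (Nat.succ_pos q)
  calc ((q + 1 : ℝ)) ^ ((q + 1) * k) * (k.factorial : ℝ) ^ (q + 1)
      ≤ ((q + 1 : ℝ)) ^ ((q + 1) * k) * (A * √k * (k / Real.exp 1) ^ k) ^ (q + 1) := by gcongr
    _ = A ^ (q + 1) * √k ^ q * (√k * ((((q + 1) * k : ℕ) : ℝ) / Real.exp 1) ^ ((q + 1) * k)) := by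
      push_cast
      rw [mul_div_assoc, mul_pow, mul_pow, mul_pow ((q : ℝ) + 1), ← pow_mul, mul_comm k (q + 1)]
      ring
    _ ≤ A ^ (q + 1) * √k ^ q * (√(((q + 1) * k : ℕ) : ℝ) *
          ((((q + 1) * k : ℕ) : ℝ) / Real.exp 1) ^ ((q + 1) * k)) := by gcongr
    _ ≤ _ := by gcongr

theorem exists_pow_le_treewidth_hanoiGraph (q : ℕ) (hq : 1 ≤ q) : ∃ C : ℝ, 0 < C ∧ ∀ n : ℕ,
    (q + 1) * (q + 2) ≤ n → ((q + 1 : ℝ)) ^ n ≤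
      C * (treewidth (hanoiGraph (3 + q) n) + 1) * (n * √n ^ q) := by
  obtain ⟨A, hA, h⟩ := exists_pow_mul_factorial_pow_le q
  refine ⟨(q + 1 : ℝ) ^ (q + 1) * (A * (64 + 192 * (3 + q))), by positivity, fun n hn => ?_⟩
  -- The residue is taken in 1, …, q + 1 rather than from 0, so that the roaming class, of size `k +
  -- e`, is strictly larger than the others.
  obtain ⟨k, e, he1, he2, rfl⟩ : ∃ k e, 1 ≤ e ∧ e ≤ q + 1 ∧ n = (q + 1) * k + e := by
    refine ⟨(n - 1) / (q + 1), (n - 1) % (q + 1) + 1, Nat.succ_le_succ (Nat.zero_le _),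
      Nat.mod_lt _ (Nat.succ_pos q), ?_⟩
    have := Nat.div_add_mod (n - 1) (q + 1)
    have : 1 ≤ n := le_trans (by nlinarith) hn
    omega
  have hk : q + 1 ≤ k := by
    by_contra! hk
    nlinarith
  set n := (q + 1) * k + e with hndef
  set tw := treewidth (hanoiGraph (3 + q) n)
  have h1 := factorial_le_treewidth_hanoiGraph (q := q) (k := k) (m := k + e) (n := n)
    (by rw [hndef]; ring) (by omega)
  have h2 := factorial_mul_factorial_add_le (r := q + 1) (by omega) (he2.trans hk)
  have h3 : ((q + 1) * k).factorial ≤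
      (64 + 192 * (3 + q)) * n * (tw + 1) * k.factorial ^ (q + 1) := by
    refine Nat.le_of_mul_le_mul_right (h2.trans ((Nat.mul_le_mul_right _ h1).trans_eq ?_))
      (Nat.factorial_pos (k + e))
    ring
  have h4 : ((q + 1 : ℝ)) ^ ((q + 1) * k) ≤
      A * √k ^ q * ((64 + 192 * (3 + q)) * n * (tw + 1)) := by
    have hpos : (0 : ℝ) < (k.factorial : ℝ) ^ (q + 1) := by positivity
    refine le_of_mul_le_mul_right ((h k (by omega)).trans ?_) hpos
    rw [mul_assoc (A * √k ^ q)]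
    gcongr
    exact_mod_cast h3
  have hkn : √(k : ℝ) ≤ √(n : ℝ) := by
    gcongr
    nlinarith
  calc ((q + 1 : ℝ)) ^ n = (q + 1 : ℝ) ^ e * (q + 1 : ℝ) ^ ((q + 1) * k) := by
        rw [hndef, pow_add, mul_comm]
    _ ≤ (q + 1 : ℝ) ^ (q + 1) * (A * √n ^ q * ((64 + 192 * (3 + q)) * n * (tw + 1))) := by
        gcongr
        · linarith [(Nat.cast_nonneg q : (0 : ℝ) ≤ q)]
        · exact h4.trans (by gcongr)
    _ = _ := by ring

theorem theorem4p8 (p : ℕ) (hp : 4 ≤ p) :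
    (fun n : ℕ => (n : ℝ) ^ (-((p : ℝ) - 1) / 2) * ((p : ℝ) - 2) ^ n) =O[Filter.atTop]
      (fun n : ℕ => (treewidth (hanoiGraph p n) : ℝ)) := by
  obtain ⟨q, rfl⟩ := Nat.exists_eq_add_of_le (by omega : 3 ≤ p)
  obtain ⟨C, hC, h⟩ := exists_pow_le_treewidth_hanoiGraph q (by omega)
  have hq : (1 : ℝ) ≤ q := by exact_mod_cast (by omega : 1 ≤ q)
  have hlim := tendsto_pow_const_div_const_pow_of_one_lt (q + 1) (by linarith : 1 < (q : ℝ) + 1)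
  refine Asymptotics.IsBigO.of_bound (2 * C) ?_
  filter_upwards [Filter.eventually_ge_atTop ((q + 1) * (q + 2)),
    hlim.eventually_lt_const (by positivity : 0 < 1 / (2 * C))] with n hn hsmall
  have hn1 : (1 : ℝ) ≤ n := by exact_mod_cast le_trans (by nlinarith) hn
  have hpow : (n : ℝ) ^ (-(((3 + q : ℕ) : ℝ) - 1) / 2) = (n * √n ^ q)⁻¹ := by
    rw [Real.sqrt_eq_rpow, ← Real.rpow_natCast, ← Real.rpow_mul (by positivity)]
    nth_rw 2 [← Real.rpow_one (n : ℝ)]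
    rw [← Real.rpow_add (by positivity), ← Real.rpow_neg (by positivity)]
    congr 1
    push_cast
    ring
  have hbase : (((3 + q : ℕ) : ℝ) - 2) = q + 1 := by push_cast; ring
  rw [hpow, hbase, Real.norm_of_nonneg (by positivity), Real.norm_of_nonneg (by positivity),
    inv_mul_le_iff₀ (by positivity)]
  have h1 := h n hn
  -- The `+ 1` added to the treewidth in `h1` costs at most half of the left side there, whence the
  -- constant `2 * C`.
  have h2 : 2 * C * (n * √n ^ q) ≤ (q + 1 : ℝ) ^ n := by
    rw [div_lt_div_iff₀ (by positivity) (by positivity)] at hsmall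
    have hs : √(n : ℝ) ^ q ≤ n ^ q := by
      gcongr
      exact Real.sqrt_le_self_iff.2 (Or.inr hn1)
    have : n * √(n : ℝ) ^ q ≤ n ^ (q + 1) := by
      rw [pow_succ']
      gcongr
    nlinarith
  nlinarith
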